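/- Let $\Gamma$ be a finite simplicial graph with vertex set $V$, and let $A_\Gamma=\langle V\mid [v,w]=1 \text{ for } v,w \text{ adjacent}\rangle$ be its right-angled Artin group. Let $\Sigma\mathrm{PAut}(A_\Gamma)$ be the group of automorphisms of $A_\Gamma$ that map each $v\in V$ to a conjugate of itself, and $\Sigma\mathrm{POut}(A_\Gamma)=\Sigma\mathrm{PAut}(A_\Gamma)/\mathrm{Inn}(A_\Gamma)$. For $a\in V$ write $\mathrm{lk}(a)$ for the set of vertices adjacent to $a$ and $\mathrm{st}(a)=\mathrm{lk}(a)\cup\{a\}$. **Whitehead poset.** A based partition $\underline A_a$ with operative factor $a$ is a partition $\{\{a\},P_1,\dots,P_k\}$ of $V\setminus \mathrm{lk}(a)$ in which each petal $P_i$ is a (non-empty) union of connected components of $\Gamma-\mathrm{st}(a)$; its length is $l(\underline A_a)=k$ (if $\mathrm{st}(a)=V$ there are no petals). Based partitions $\underline A_a,\underline B_b$ are compatible if $a\in\mathrm{st}(b)$, or if there are no petals $P$ of $\underline A_a$ and $Q$ of $\underline B_b$ with $a\notin Q$, $b\notin P$ and $P\cap Q\neq\emptyset$. A vertex type $A$ is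 a family $(\underline A_a)_{a\in V}$ of pairwise compatible based partitions, one for each operative factor. Put $A\le B$ if for every $a\in V$ each petal of $\underline B_a$ is contained in a petal of $\underline A_a$. The poset of vertex types is the $\Gamma$-Whitehead poset $\mathrm{Wh}_\Gamma$. The rank of $A$ is $r(A)=\sum_{a\in V}\max\{l(\underline A_a)-1,0\}$. **McCullough–Miller complex.** An automorphism $\alpha\in\Sigma\mathrm{PAut}(A_\Gamma)$ is carried by $\underline A_a$ if there are integers $k_b$ $(b\in V)$ with $\alpha(b)=a^{k_b}\,b\,a^{-k_b}$ for all $b\in V$ and $k_b=k_c$ whenever $b,c$ lie in the same petal; it is carried by $A$ if it is a finite product of automorphisms each carried by some $\underline A_a$. A basis is a family $X=\delta(V)=(\delta(v))_{v\in V}$ with $\delta\in\Sigma\mathrm{PAut}(A_\Gamma)$, and $\alpha$ is carried by the marked vertex type $(X,A)$ if $\delta^{-1}\alpha\delta$ is carried by $A$. Marked vertex types $(X_1,A)$ and $(X_2,A)$ are equivalent if some $\alpha$ carried by $(X_1,A)$ satisfies $\alpha(X_1)=X_2$; the class of $(X,A)$ is denoted $[X,A]$. These classes form a poset, in which $x\le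 y$ if and only if $x=[X,A]$ and $y=[X,B]$ for some basis $X$ and vertex types $A\le B$. The $\Gamma$-McCullough–Miller complex $\mathrm{MM}_\Gamma$ is the simplicial realization of this poset, i.e. its simplices are the non-empty finite chains. **Theorem A.** The group $\Sigma\mathrm{POut}(A_\Gamma)$ acts on $\mathrm{MM}_\Gamma$ by $\alpha\cdot[X,A]=[\alpha(X),A]$; it acts by order automorphisms of the poset, hence simplicially, and by homeomorphisms of the geometric realization. Moreover: 1. The (setwise) stabilizer of every cell of $\mathrm{MM}_\Gamma$ is free abelian (of finite rank) and fixes the cell pointwise. 2. The stabilizer of a vertex $[X,A]$ is free abelian of rank $r(A)$. 3. The map $A\mapsto[V,A]$ is an order embedding, and induces a closed embedding of the realization $|\mathrm{Wh}_\Gamma|$ onto the full subcomplex of $|\mathrm{MM}_\Gamma|$ spanned by the vertices $[V,A]$. This subcomplex is a strong fundamental domain: it meets every $\Sigma\mathrm{POut}(A_\Gamma)$-orbit of points of $|\mathrm{MM}_\Gamma|$ in exactly one point. -/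

import Mathlib

namespace GammaMM

/-! ### Simplicial complexes and their realizations -/

section Realization

/-- The simplicial realization of a poset as an abstract simplicial complex: the simplices are
the nonempty finite chains. -/
def orderComplex (P : Type*) [PartialOrder P] : AbstractSimplicialComplex P where
  faces := {s | s.Nonempty ∧ IsChain (· ≤ ·) (s : Set P)}
  isRelLowerSet_faces := fun _ hs =>
    ⟨hs.1, fun _ hts ht => ⟨ht, hs.2.mono (by exact_mod_cast hts)⟩⟩
  singleton_mem := fun v => ⟨Finset.singleton_nonempty v, by simp⟩

variable {ι κ : Type*}

/-- The points of the geometric realization of `K`, in barycentric coordinates. -/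
@[ext]
structure Realization (K : AbstractSimplicialComplex ι) where
  coord : ι →₀ ℝ
  nonneg : ∀ i, 0 ≤ coord i
  sum_eq_one : (coord.sum fun _ r => r) = 1
  support_mem : coord.support ∈ K

namespace Realization

/-- The carrier of a point: the vertices of the unique open simplex that contains it. -/
def carrier {K : AbstractSimplicialComplex ι} (x : Realization K) : Finset ι := x.coord.support

/-- The closed simplex of the realization spanned by a set of vertices. -/
def closedCell (K : AbstractSimplicialComplex ι) (s : Finset ι) : Set (Realization K) :=
  {x | x.carrier ⊆ s}

/-- The weak topology: the finest topology such that the inclusion of every closed simplex, with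
its Euclidean topology (the one given by the barycentric coordinates), is continuous. -/
instance (K : AbstractSimplicialComplex ι) : TopologicalSpace (Realization K) :=
  ⨆ s : {s : Finset ι // s ∈ K},
    TopologicalSpace.coinduced (fun x : closedCell K s.1 => x.1)
      (TopologicalSpace.induced (fun (x : closedCell K s.1) (i : ι) => x.1.coord i)
        Pi.topologicalSpace)

open Classical in
/-- The map of realizations induced by a simplicial map, affine on every simplex. -/
noncomputable def map {K : AbstractSimplicialComplex ι} {L : AbstractSimplicialComplex κ}
    (f : ι → κ) (hf : ∀ s ∈ K, s.image f ∈ L) (x : Realization K) : Realization L :=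
  have hn : ∀ i, 0 ≤ x.coord.mapDomain f i := by
    intro i
    rw [Finsupp.mapDomain, Finsupp.sum_apply]
    refine Finset.sum_nonneg fun j _ => ?_
    change 0 ≤ (Finsupp.single (f j) (x.coord j)) i
    rw [Finsupp.single_apply]
    split_ifs
    · exact x.nonneg j
    · exact le_rfl
  have hs : ((x.coord.mapDomain f).sum fun _ r => r) = 1 := by
    rw [Finsupp.sum_mapDomain_index (fun _ => rfl) (fun _ _ _ => rfl)]
    exact x.sum_eq_one
  have hne : (x.coord.mapDomain f).support.Nonempty := by
    rw [Finset.nonempty_iff_ne_empty]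
    intro he
    rw [Finsupp.sum, he, Finset.sum_empty] at hs
    exact zero_ne_one hs
  { coord := x.coord.mapDomain f
    nonneg := hn
    sum_eq_one := hs
    support_mem := (L.isRelLowerSet_faces (hf _ x.support_mem)).2 Finsupp.mapDomain_support hne }

/-- A subcomplex of the realization: a union of closed simplices. -/
def IsSubcomplex {K : AbstractSimplicialComplex ι} (F : Set (Realization K)) : Prop :=
  ∃ S : Set (Finset ι), (∀ s ∈ S, s ∈ K) ∧ F = ⋃ s ∈ S, closedCell K s

/-- A strong fundamental domain: a subcomplex that meets every orbit in exactly one point. -/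
def IsStrongFundamentalDomain (G : Type*) [Group G] {K : AbstractSimplicialComplex ι}
    [MulAction G (Realization K)] (F : Set (Realization K)) : Prop :=
  IsSubcomplex F ∧ ∀ x : Realization K, ∃! y, y ∈ F ∧ y ∈ MulAction.orbit G x

end Realization

open Classical in
theorem image_mem_orderComplex {P Q : Type*} [PartialOrder P] [PartialOrder Q] (f : P →o Q) :
    ∀ s ∈ orderComplex P, s.image f ∈ orderComplex Q := by
  intro s hs
  refine ⟨hs.1.image f, ?_⟩
  rw [Finset.coe_image]
  rintro _ ⟨a, ha, rfl⟩ _ ⟨b, hb, rfl⟩ -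
  rcases hs.2.total ha hb with h | h
  · exact Or.inl (f.monotone h)
  · exact Or.inr (f.monotone h)

/-- The map `|f| : |P| → |Q|` induced by a poset map. -/
noncomputable def realize {P Q : Type*} [PartialOrder P] [PartialOrder Q] (f : P →o Q) :
    Realization (orderComplex P) → Realization (orderComplex Q) :=
  Realization.map f (image_mem_orderComplex f)

end Realization

/-! ### Free abelian groups -/

/-- `G` is a free abelian group of rank `n`. -/
def IsFreeAbelianOfRank (G : Type*) [Group G] (n : ℕ) : Prop :=
  Nonempty (G ≃* Multiplicative (Fin n → ℤ))

/-! ### Right-angled Artin groups and pure symmetric automorphisms -/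

variable {V : Type*} (Γ : SimpleGraph V)

/-- The commutators `[v, w]` of adjacent vertices. -/
def rels : Set (FreeGroup V) :=
  {r | ∃ v w, Γ.Adj v w ∧
    r = FreeGroup.of v * FreeGroup.of w * (FreeGroup.of v)⁻¹ * (FreeGroup.of w)⁻¹}

/-- The right-angled Artin group `A_Γ`. -/
abbrev RAAG : Type _ := PresentedGroup (rels Γ)

/-- The standard generators of `A_Γ`. -/
def gen (v : V) : RAAG Γ := PresentedGroup.of v

/-- `ΣPAut(A_Γ)`: the automorphisms that map each standard generator to a conjugate of itself. -/
def PAut : Subgroup (MulAut (RAAG Γ)) where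
  carrier := {α | ∀ v, IsConj (gen Γ v) (α (gen Γ v))}
  one_mem' := fun v => IsConj.refl _
  mul_mem' := by
    intro α β hα hβ v
    exact (hα v).trans (by simpa using (α : RAAG Γ →* RAAG Γ).map_isConj (hβ v))
  inv_mem' := by
    intro α hα v
    have h := ((α⁻¹ : MulAut (RAAG Γ)) : RAAG Γ →* RAAG Γ).map_isConj (hα v)
    simpa using h.symm

/-- The inner automorphisms, as a subgroup of `ΣPAut(A_Γ)`. -/
def Inn : Subgroup (PAut Γ) := (MulAut.conj : RAAG Γ →* MulAut (RAAG Γ)).range.subgroupOf (PAut Γ)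

instance : (Inn Γ).Normal := by
  constructor
  rintro n ⟨g, hg⟩ α
  refine ⟨(α : MulAut (RAAG Γ)) g, ?_⟩
  ext x
  have hn : (n : MulAut (RAAG Γ)) = MulAut.conj g := hg.symm
  simp [hn]

/-- `ΣPOut(A_Γ) = ΣPAut(A_Γ) / Inn(A_Γ)`. -/
abbrev POut : Type _ := PAut Γ ⧸ Inn Γ

/-! ### Based partitions, vertex types, and the Whitehead poset -/

/-- The star of a vertex. -/
def vstar (a : V) : Set V := {b | b = a ∨ Γ.Adj a b}

/-- `P` is a union of connected components of `Γ - st(a)`. -/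
def IsUnionOfComponents (a : V) (P : Set V) : Prop :=
  ∃ S : Set (Γ.induce (vstar Γ a)ᶜ).ConnectedComponent,
    P = ⋃ C ∈ S, Subtype.val '' C.supp

/-- A `Γ`-valid based partition `{{a}, P₁, …, P_k}` of `Γ - lk(a)` with operative factor `a`, given
by its set of petals `{P₁, …, P_k}`, which is a partition of `Γ - st(a)`. When `Γ = st(a)` there are
no petals, and this is the trivial based partition. -/
@[ext]
structure BasedPartition (a : V) where
  petals : Set (Set V)
  nonempty : ∀ P ∈ petals, P.Nonempty
  disjoint : petals.PairwiseDisjoint id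
  sUnion_eq : ⋃₀ petals = (vstar Γ a)ᶜ
  valid : ∀ P ∈ petals, IsUnionOfComponents Γ a P

variable {Γ}

/-- The number of petals. -/
noncomputable def BasedPartition.length {a : V} (A : BasedPartition Γ a) : ℕ := A.petals.ncard

/-- Two based partitions cross. -/
def BasedPartition.Cross {a b : V} (A : BasedPartition Γ a) (B : BasedPartition Γ b) : Prop :=
  a ∉ vstar Γ b ∧ ∃ P ∈ A.petals, ∃ Q ∈ B.petals, a ∉ Q ∧ b ∉ P ∧ (P ∩ Q).Nonempty

/-- Two based partitions are compatible: their operative factors are equal or adjacent, or they do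
not cross. -/
def BasedPartition.Compatible {a b : V} (A : BasedPartition Γ a) (B : BasedPartition Γ b) : Prop :=
  a ∈ vstar Γ b ∨ ¬ A.Cross B

/-- `A ≤ B` if every petal of `B` is contained in a petal of `A`. -/
instance (a : V) : PartialOrder (BasedPartition Γ a) where
  le A B := ∀ Q ∈ B.petals, ∃ P ∈ A.petals, Q ⊆ P
  le_refl A := fun P hP => ⟨P, hP, subset_rfl⟩
  le_trans A B C hAB hBC := fun R hR => by
    obtain ⟨Q, hQ, hRQ⟩ := hBC R hR
    obtain ⟨P, hP, hQP⟩ := hAB Q hQ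
    exact ⟨P, hP, hRQ.trans hQP⟩
  le_antisymm := by
    have key : ∀ A B : BasedPartition Γ a,
        (∀ Q ∈ B.petals, ∃ P ∈ A.petals, Q ⊆ P) → (∀ Q ∈ A.petals, ∃ P ∈ B.petals, Q ⊆ P) →
        B.petals ⊆ A.petals := by
      intro A B hAB hBA Q hQ
      obtain ⟨P, hP, hQP⟩ := hAB Q hQ
      obtain ⟨Q', hQ', hPQ'⟩ := hBA P hP
      obtain ⟨x, hx⟩ := B.nonempty Q hQ
      have hQQ' : Q = Q' := B.disjoint.elim_set hQ hQ' x hx (hPQ' (hQP hx))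
      have : Q = P := subset_antisymm hQP (hQQ' ▸ hPQ')
      exact this ▸ hP
    intro A B hAB hBA
    exact BasedPartition.ext (subset_antisymm (key B A hBA hAB) (key A B hAB hBA))

variable (Γ) in
/-- A `Γ`-vertex type: pairwise compatible based partitions, one for each operative factor. As a
partially ordered set, this is the `Γ`-Whitehead poset `Wh_Γ`. -/
@[ext]
structure VertexType where
  part : ∀ a : V, BasedPartition Γ a
  compatible : ∀ a b, (part a).Compatible (part b)

/-- The order of the Whitehead poset. -/
instance : PartialOrder (VertexType Γ) where
  le A B := ∀ a, A.part a ≤ B.part a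
  le_refl A := fun a => le_rfl
  le_trans A B C hAB hBC := fun a => (hAB a).trans (hBC a)
  le_antisymm A B hAB hBA := VertexType.ext (funext fun a => (hAB a).antisymm (hBA a))

/-- The rank `r(A) = ∑ (l(A_a) - 1)` of a vertex type. The subtraction is truncated: if
`Γ = st(a)`, the only based partition with operative factor `a` is trivial and contributes `0`. -/
noncomputable def VertexType.rank [Fintype V] (A : VertexType Γ) : ℕ :=
  ∑ a, ((A.part a).length - 1)

/-! ### Carried automorphisms -/

/-- `α` is carried by the based partition `A` with operative factor `a`: it conjugates every
generator by a power of `a`, and the power is constant on petals. In particular it fixes every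
generator in the star of `a`. -/
def BasedPartition.Carries {a : V} (A : BasedPartition Γ a) (α : PAut Γ) : Prop :=
  ∃ k : V → ℤ,
    (∀ b, (α : MulAut (RAAG Γ)) (gen Γ b) = gen Γ a ^ k b * gen Γ b * (gen Γ a ^ k b)⁻¹) ∧
    ∀ P ∈ A.petals, ∀ b ∈ P, ∀ c ∈ P, k b = k c

/-- `α` is carried by the vertex type `A`: it is a finite product of automorphisms each of which is
carried by some based partition of `A`. -/
def VertexType.Carries (A : VertexType Γ) (α : PAut Γ) : Prop :=
  α ∈ Submonoid.closure {β : PAut Γ | ∃ a, (A.part a).Carries β}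

theorem commute_gen {a b : V} (h : b ∈ vstar Γ a) : Commute (gen Γ a) (gen Γ b) := by
  rcases h with rfl | h
  · exact Commute.refl _
  · have h1 : gen Γ a * gen Γ b * (gen Γ a)⁻¹ * (gen Γ b)⁻¹ = 1 :=
      PresentedGroup.one_of_mem (rels := rels Γ) ⟨a, b, h, rfl⟩
    exact mul_inv_eq_iff_eq_mul.1 (mul_inv_eq_one.1 h1)

theorem BasedPartition.Carries.inv {a : V} {A : BasedPartition Γ a} {α : PAut Γ}
    (h : A.Carries α) : A.Carries α⁻¹ := by
  obtain ⟨k, hk, hc⟩ := h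
  refine ⟨fun b => -k b, fun b => ?_, fun P hP b hb c hc' => by simp [hc P hP b hb c hc']⟩
  have ha : (α : MulAut (RAAG Γ)) (gen Γ a) = gen Γ a := by
    rw [hk a, ((Commute.refl (gen Γ a)).zpow_left (k a)).eq, mul_inv_cancel_right]
  rw [Subgroup.coe_inv, MulAut.inv_def, MulEquiv.symm_apply_eq]
  simp only [map_mul, map_inv, map_zpow, ha, hk b]
  group

theorem BasedPartition.Carries.mono {a : V} {A B : BasedPartition Γ a} (hAB : A ≤ B) {α : PAut Γ}
    (h : A.Carries α) : B.Carries α := by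
  obtain ⟨k, hk, hc⟩ := h
  refine ⟨k, hk, fun Q hQ b hb c hc' => ?_⟩
  obtain ⟨P, hP, hQP⟩ := hAB Q hQ
  exact hc P hP b (hQP hb) c (hQP hc')

namespace VertexType

theorem Carries.one (A : VertexType Γ) : A.Carries 1 := Submonoid.one_mem _

theorem Carries.mul {A : VertexType Γ} {α β : PAut Γ} (hα : A.Carries α) (hβ : A.Carries β) :
    A.Carries (α * β) := Submonoid.mul_mem _ hα hβ

theorem Carries.inv {A : VertexType Γ} {α : PAut Γ} (h : A.Carries α) : A.Carries α⁻¹ := by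
  induction h using Submonoid.closure_induction with
  | mem x hx =>
    obtain ⟨a, ha⟩ := hx
    exact Submonoid.subset_closure ⟨a, ha.inv⟩
  | one => rw [inv_one]; exact Carries.one A
  | mul x y _ _ hx hy => rw [mul_inv_rev]; exact Carries.mul hy hx

theorem Carries.mono {A B : VertexType Γ} (hAB : A ≤ B) {α : PAut Γ} (h : A.Carries α) :
    B.Carries α := by
  refine Submonoid.closure_mono ?_ h
  rintro β ⟨a, ha⟩
  exact ⟨a, ha.mono (hAB a)⟩

theorem carries_inner (A : VertexType Γ) (α : PAut Γ) (h : α ∈ Inn Γ) : A.Carries α := by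
  obtain ⟨g, hg⟩ := h
  have key : ∀ g : RAAG Γ, ∀ α : PAut Γ, MulAut.conj g = (α : MulAut (RAAG Γ)) → A.Carries α := by
    intro g
    have hg : g ∈ Subgroup.closure (Set.range (gen Γ)) := by
      have : Subgroup.closure (Set.range (gen Γ)) = ⊤ := PresentedGroup.closure_range_of (rels Γ)
      exact this.symm ▸ Subgroup.mem_top g
    have hmem : ∀ x : RAAG Γ, MulAut.conj x ∈ PAut Γ := fun x v =>
      isConj_iff.2 ⟨x, rfl⟩
    induction hg using Subgroup.closure_induction with
    | mem x hx =>
      obtain ⟨a, rfl⟩ := hx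
      intro α hα
      refine Submonoid.subset_closure ⟨a, fun _ => 1, fun b => ?_, fun _ _ _ _ _ _ => rfl⟩
      rw [← hα, MulAut.conj_apply, zpow_one]
    | one =>
      intro α hα
      have : α = 1 := Subtype.ext (by rw [← hα, map_one]; rfl)
      rw [this]; exact Carries.one A
    | mul x y _ _ hx hy =>
      intro α hα
      have : α = ⟨MulAut.conj x, hmem x⟩ * ⟨MulAut.conj y, hmem y⟩ :=
        Subtype.ext (by rw [← hα, map_mul]; rfl)
      rw [this]
      exact Carries.mul (hx _ rfl) (hy _ rfl)
    | inv x _ hx =>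
      intro α hα
      have : α = (⟨MulAut.conj x, hmem x⟩ : PAut Γ)⁻¹ :=
        Subtype.ext (by rw [← hα, map_inv]; rfl)
      rw [this]
      exact (hx _ rfl).inv
  exact key g α hg

end VertexType

/-! ### Markings and the McCullough–Miller poset -/

variable (Γ) in
/-- The (ordered) bases of `A_Γ`: the images `α(V_Γ)` of the standard generating system under
`α ∈ ΣPAut(A_Γ)`. -/
@[ext]
structure OrderedBasis where
  elt : V → RAAG Γ
  exists_aut : ∃ α : PAut Γ, ∀ v, elt v = (α : MulAut (RAAG Γ)) (gen Γ v)

variable (Γ) in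
/-- The standard basis `V_Γ`. -/
def stdBasis : OrderedBasis Γ := ⟨gen Γ, 1, fun _ => rfl⟩

/-- `ΣPAut(A_Γ)` acts on bases by `α(X) = (α(X v))_v`. -/
instance : MulAction (PAut Γ) (OrderedBasis Γ) where
  smul α X := ⟨fun v => (α : MulAut (RAAG Γ)) (X.elt v), by
    obtain ⟨β, hβ⟩ := X.exists_aut
    exact ⟨α * β, fun v => by rw [hβ v]; rfl⟩⟩
  one_smul _ := rfl
  mul_smul _ _ _ := rfl

theorem exists_smul_stdBasis (X : OrderedBasis Γ) : ∃ δ : PAut Γ, X = δ • stdBasis Γ := by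
  obtain ⟨δ, hδ⟩ := X.exists_aut
  exact ⟨δ, OrderedBasis.ext (funext hδ)⟩

theorem smul_stdBasis_injective {α β : PAut Γ} (h : α • stdBasis Γ = β • stdBasis Γ) : α = β := by
  apply Subtype.ext
  apply MulEquiv.toMonoidHom_injective
  refine PresentedGroup.ext fun v => ?_
  exact congrFun (congrArg OrderedBasis.elt h) v

variable (Γ) in
/-- The marked vertex types `(X, A)`. -/
structure MarkedVertexType where
  basis : OrderedBasis Γ
  type : VertexType Γ

namespace MarkedVertexType

/-- `α` is carried by `(X, A)`: `γ α γ⁻¹` is carried by `A`, where `γ(X) = V_Γ`. -/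
def Carries (m : MarkedVertexType Γ) (α : PAut Γ) : Prop :=
  ∃ γ : PAut Γ, γ • m.basis = stdBasis Γ ∧ m.type.Carries (γ * α * γ⁻¹)

theorem carries_iff (δ : PAut Γ) (A : VertexType Γ) (α : PAut Γ) :
    (⟨δ • stdBasis Γ, A⟩ : MarkedVertexType Γ).Carries α ↔ A.Carries (δ⁻¹ * α * δ) := by
  constructor
  · rintro ⟨γ, hγ, h⟩
    have : γ = δ⁻¹ := by
      rw [smul_smul] at hγ
      exact eq_inv_of_mul_eq_one_left (smul_stdBasis_injective (hγ.trans (one_smul _ _).symm))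
    simpa [this] using h
  · intro h
    exact ⟨δ⁻¹, inv_smul_smul _ _, by simpa using h⟩

/-- `(X₁, A) ≤ (X₂, B)` if `X₁ = X₂` and `A ≤ B`. -/
instance : LE (MarkedVertexType Γ) := ⟨fun m n => m.basis = n.basis ∧ m.type ≤ n.type⟩

/-- `α(X, A) = (α(X), A)`. -/
instance : MulAction (PAut Γ) (MarkedVertexType Γ) where
  smul α m := ⟨α • m.basis, m.type⟩
  one_smul _ := rfl
  mul_smul _ _ _ := rfl

/-- `(X₁, A) ≡ (X₂, A)` if some `α` carried by `(X₁, A)` maps `X₁` to `X₂`. -/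
def Equivalent (m n : MarkedVertexType Γ) : Prop :=
  m.type = n.type ∧ ∃ α : PAut Γ, m.Carries α ∧ α • m.basis = n.basis

theorem equivalent_iff (δ ε : PAut Γ) (A B : VertexType Γ) :
    (⟨δ • stdBasis Γ, A⟩ : MarkedVertexType Γ).Equivalent ⟨ε • stdBasis Γ, B⟩ ↔
      A = B ∧ A.Carries (δ⁻¹ * ε) := by
  unfold Equivalent
  refine and_congr_right fun _ => ⟨?_, fun h => ⟨ε * δ⁻¹, ?_, ?_⟩⟩
  · rintro ⟨α, hα, h⟩
    rw [carries_iff] at hα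
    have : α * δ = ε := smul_stdBasis_injective (by simpa [mul_smul] using h)
    rw [← this, ← mul_assoc]
    exact hα
  · rw [carries_iff]
    simpa [mul_assoc] using h
  · simp [smul_smul]

theorem exists_eq (m : MarkedVertexType Γ) :
    ∃ (δ : PAut Γ) (A : VertexType Γ), m = ⟨δ • stdBasis Γ, A⟩ := by
  obtain ⟨δ, hδ⟩ := exists_smul_stdBasis m.basis
  exact ⟨δ, m.type, by rw [← hδ]⟩

variable (Γ) in
/-- `≡` is an equivalence relation. -/
def setoid : Setoid (MarkedVertexType Γ) where
  r := Equivalent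
  iseqv := by
    constructor
    · intro m
      obtain ⟨δ, A, rfl⟩ := m.exists_eq
      rw [equivalent_iff]
      exact ⟨rfl, by rw [inv_mul_cancel]; exact VertexType.Carries.one A⟩
    · intro m n
      obtain ⟨δ, A, rfl⟩ := m.exists_eq
      obtain ⟨ε, B, rfl⟩ := n.exists_eq
      rw [equivalent_iff, equivalent_iff]
      rintro ⟨rfl, h⟩
      exact ⟨rfl, by simpa using h.inv⟩
    · intro m n p
      obtain ⟨δ, A, rfl⟩ := m.exists_eq
      obtain ⟨ε, B, rfl⟩ := n.exists_eq
      obtain ⟨ζ, C, rfl⟩ := p.exists_eq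
      rw [equivalent_iff, equivalent_iff, equivalent_iff]
      rintro ⟨rfl, h⟩ ⟨rfl, h'⟩
      exact ⟨rfl, by simpa [mul_assoc] using h.mul h'⟩

end MarkedVertexType

variable (Γ) in
/-- The `Γ`-McCullough–Miller poset: equivalence classes `[X, A]` of marked vertex types. -/
def MM : Type _ := Quotient (MarkedVertexType.setoid Γ)

namespace MM

/-- The class `[X, A]`. -/
def mk (X : OrderedBasis Γ) (A : VertexType Γ) : MM Γ :=
  Quotient.mk (MarkedVertexType.setoid Γ) ⟨X, A⟩

theorem mk_eq_iff (δ ε : PAut Γ) (A B : VertexType Γ) :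
    mk (δ • stdBasis Γ) A = mk (ε • stdBasis Γ) B ↔ A = B ∧ A.Carries (δ⁻¹ * ε) := by
  rw [← MarkedVertexType.equivalent_iff]
  exact Quotient.eq

theorem mk_eq_type {X Y : OrderedBasis Γ} {A B : VertexType Γ} (h : mk X A = mk Y B) : A = B :=
  (Quotient.exact h : MarkedVertexType.Equivalent _ _).1

theorem mk_eq_of_le {X Y : OrderedBasis Γ} {A B : VertexType Γ} (hAB : A ≤ B)
    (h : mk X A = mk Y A) : mk X B = mk Y B := by
  obtain ⟨δ, rfl⟩ := exists_smul_stdBasis X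
  obtain ⟨ε, rfl⟩ := exists_smul_stdBasis Y
  rw [mk_eq_iff] at h ⊢
  exact ⟨rfl, h.2.mono hAB⟩

theorem ind {p : MM Γ → Prop} (h : ∀ X A, p (mk X A)) (x : MM Γ) : p x :=
  Quotient.ind (fun m => h m.basis m.type) x

/-- The induced partial order: `x ≤ y` if `x` and `y` have representatives `m ≤ n`. -/
instance : PartialOrder (MM Γ) where
  le x y := ∃ m n : MarkedVertexType Γ, m ≤ n ∧ x = mk m.basis m.type ∧ y = mk n.basis n.type
  le_refl := ind fun X A => ⟨⟨X, A⟩, ⟨X, A⟩, ⟨rfl, le_rfl⟩, rfl, rfl⟩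
  le_trans := by
    rintro x y z ⟨⟨X, A⟩, ⟨_, B⟩, ⟨rfl, hAB⟩, rfl, rfl⟩ ⟨⟨Y, B'⟩, ⟨_, C⟩, ⟨rfl, hBC⟩, h, rfl⟩
    obtain rfl : B = B' := mk_eq_type h
    exact ⟨⟨X, A⟩, ⟨X, C⟩, ⟨rfl, le_trans hAB hBC⟩, rfl, (mk_eq_of_le hBC h).symm⟩
  le_antisymm := by
    rintro x y ⟨⟨X, A⟩, ⟨_, B⟩, ⟨rfl, hAB⟩, rfl, rfl⟩ ⟨⟨Y, B'⟩, ⟨_, A'⟩, ⟨rfl, hBA⟩, h, h'⟩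
    obtain rfl : B = B' := mk_eq_type h
    obtain rfl : A = A' := mk_eq_type h'
    obtain rfl : A = B := le_antisymm hAB hBA
    rfl

/-- The order automorphism `[X, A] ↦ [α(X), A]`. -/
def autAct (α : PAut Γ) (x : MM Γ) : MM Γ :=
  Quotient.map (sa := MarkedVertexType.setoid Γ) (sb := MarkedVertexType.setoid Γ)
    (fun m => α • m) (by
      intro m n h
      obtain ⟨δ, A, rfl⟩ := m.exists_eq
      obtain ⟨ε, B, rfl⟩ := n.exists_eq
      have h' := (MarkedVertexType.equivalent_iff δ ε A B).1 h
      change MarkedVertexType.Equivalent ⟨α • δ • stdBasis Γ, A⟩ ⟨α • ε • stdBasis Γ, B⟩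
      rw [smul_smul, smul_smul, MarkedVertexType.equivalent_iff]
      exact ⟨h'.1, by simpa [mul_assoc] using h'.2⟩) x

/-- The action of `ΣPAut(A_Γ)` on the set of classes. -/
def autHom : PAut Γ →* Equiv.Perm (MM Γ) :=
  letI : MulAction (PAut Γ) (MM Γ) :=
    { smul := autAct
      one_smul := ind fun _ _ => rfl
      mul_smul := fun _ _ => ind fun _ _ => rfl }
  MulAction.toPermHom (PAut Γ) (MM Γ)

theorem autHom_apply (α : PAut Γ) (X : OrderedBasis Γ) (A : VertexType Γ) :
    autHom α (mk X A) = mk (α • X) A := rfl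

theorem inner_le_ker : Inn Γ ≤ (autHom (Γ := Γ)).ker := by
  intro α hα
  rw [MonoidHom.mem_ker]
  refine Equiv.ext (ind fun X A => ?_)
  rw [autHom_apply, Equiv.Perm.one_apply]
  obtain ⟨δ, rfl⟩ := exists_smul_stdBasis X
  rw [smul_smul, mk_eq_iff]
  refine ⟨rfl, A.carries_inner _ ?_⟩
  have := (inferInstance : (Inn Γ).Normal).conj_mem _ ((Inn Γ).inv_mem hα) δ⁻¹
  simpa [mul_assoc] using this

/-- The induced action of `ΣPOut(A_Γ)` on the McCullough–Miller poset:
`[α] • [X, A] = [α(X), A]`. -/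
instance : MulAction (POut Γ) (MM Γ) :=
  MulAction.compHom (MM Γ) (QuotientGroup.lift (Inn Γ) autHom inner_le_ker)

theorem mk_smul_mk (α : PAut Γ) (X : OrderedBasis Γ) (A : VertexType Γ) :
    (QuotientGroup.mk α : POut Γ) • mk X A = mk (α • X) A := rfl

theorem smul_mono (g : POut Γ) {x y : MM Γ} (h : x ≤ y) : g • x ≤ g • y := by
  obtain ⟨α, rfl⟩ := QuotientGroup.mk_surjective g
  obtain ⟨⟨X, A⟩, ⟨_, B⟩, ⟨rfl, hAB⟩, rfl, rfl⟩ := h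
  exact ⟨⟨α • X, A⟩, ⟨α • X, B⟩, ⟨rfl, hAB⟩, rfl, rfl⟩

/-- The poset map given by an element of `ΣPOut(A_Γ)`. -/
def smulHom (g : POut Γ) : MM Γ →o MM Γ := ⟨fun x => g • x, fun _ _ h => smul_mono g h⟩

variable (Γ) in
/-- The `Γ`-McCullough–Miller complex: the simplicial realization of the poset. -/
abbrev Complex : AbstractSimplicialComplex (MM Γ) := orderComplex (MM Γ)

open scoped Pointwise in
/-- The (setwise) stabilizer of a simplex. -/
def cellStabilizer (σ : Finset (MM Γ)) : Subgroup (POut Γ) :=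
  MulAction.stabilizer (POut Γ) (σ : Set (MM Γ))

/-- The simplicial action of `ΣPOut(A_Γ)` on the geometric realization `|MM_Γ|`. -/
noncomputable instance : MulAction (POut Γ) (Realization (Complex Γ)) where
  smul g := realize (smulHom g)
  one_smul x := Realization.ext (by
    change Finsupp.mapDomain (fun p : MM Γ => (1 : POut Γ) • p) x.coord = x.coord
    simp only [one_smul]
    exact Finsupp.mapDomain_id)
  mul_smul g h x := Realization.ext (by
    change Finsupp.mapDomain (fun p : MM Γ => (g * h) • p) x.coord =
      Finsupp.mapDomain (fun p : MM Γ => g • p) (Finsupp.mapDomain (fun p : MM Γ => h • p) x.coord)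
    rw [← Finsupp.mapDomain_comp]
    simp only [mul_smul]
    rfl)

variable (Γ) in
/-- The poset map `Wh_Γ → MM_Γ`, `A ↦ [V_Γ, A]`. -/
def ofVertexType : VertexType Γ →o MM Γ :=
  ⟨fun A => mk (stdBasis Γ) A, fun A B h =>
    ⟨⟨stdBasis Γ, A⟩, ⟨stdBasis Γ, B⟩, ⟨rfl, h⟩, rfl, rfl⟩⟩

end MM

end GammaMM

/-! The map `typeHom`, `[X, A] ↦ A`, is order preserving, constant on orbits, and a left inverse of
`A ↦ [V, A]`. Comparable classes have a common marking, so comparable classes of equal type coincide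
(`eq_of_le_of_typeHom_eq`). Hence a group element preserving a chain fixes each of its vertices. As
larger types carry more automorphisms, stabilizers grow along the order, and the stabilizer of a
chain is that of its least vertex. A marking of the least vertex marks the whole chain, so one
translation moves the chain to the standard marking; the type map on realizations gives uniqueness
in each orbit as well as the closed embedding.

The rest is the stabilizer of `[V, A]`: the outer classes carried by `A`, generated by the subgroups
carried by the single partitions `A.part a`. Compatibility makes these subgroups commute in `POut Γ`
(`Compatible.commute`). For `b ∉ st(a)`, a Heisenberg quotient of `A_Γ` reads off the exponent sum
of `a` in the conjugator of `b`; this is a homomorphism (`twistExp`), and differences of two of them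
kill inner automorphisms (`relExp`). These differences are coordinates on the subgroup of `a`,
identify it with `ℤ^(l - 1)`, and vanish on the subgroups of other operative factors. So the product
is direct, of rank `r(A)`. -/

namespace GammaMM

/-! ### The topology of realizations -/

namespace Realization

variable {ι κ : Type*} {K : AbstractSimplicialComplex ι} {L : AbstractSimplicialComplex κ}

/-- The Euclidean topology on a closed simplex. -/
abbrev cellTopology (K : AbstractSimplicialComplex ι) (s : Finset ι) :
    TopologicalSpace (closedCell K s) :=
  TopologicalSpace.induced (fun (x : closedCell K s) (i : ι) => x.1.coord i) Pi.topologicalSpace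

theorem continuous_closedCell_val {s : Finset ι} (hs : s ∈ K) :
    @Continuous _ _ (cellTopology K s) _ (fun x : closedCell K s => x.1) :=
  continuous_iff_coinduced_le.2 (le_iSup (fun s : {s : Finset ι // s ∈ K} =>
    TopologicalSpace.coinduced (fun x : closedCell K s.1 => x.1) (cellTopology K s.1)) ⟨s, hs⟩)

theorem continuous_of_closedCell {X : Type*} [TopologicalSpace X] {f : Realization K → X}
    (h : ∀ s ∈ K, @Continuous _ _ (cellTopology K s) _ (fun x : closedCell K s => f x.1)) :
    Continuous f :=
  continuous_iSup_dom.2 fun s => continuous_coinduced_dom.2 (h s.1 s.2)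

theorem continuous_closedCell_coord (s : Finset ι) (i : ι) :
    @Continuous _ _ (cellTopology K s) _ (fun x : closedCell K s => x.1.coord i) := by
  let := cellTopology K s
  exact (continuous_apply i).comp
    (continuous_induced_dom (f := fun (x : closedCell K s) (i : ι) => x.1.coord i))

theorem continuous_coord (i : ι) : Continuous fun x : Realization K => x.coord i :=
  continuous_of_closedCell fun s _ => continuous_closedCell_coord s i

/-- The barycentric coordinates are continuous and separate points. Being Hausdorff makes the image
of a map with a continuous left inverse closed. -/
instance : T2Space (Realization K) :=
  T2Space.of_injective_continuous (f := fun (x : Realization K) (i : ι) => x.coord i)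
    (fun _ _ h => Realization.ext (DFunLike.coe_injective h)) (continuous_pi continuous_coord)

open Classical in
theorem map_carrier_subset (f : ι → κ) (hf : ∀ s ∈ K, s.image f ∈ L) (x : Realization K) :
    (map f hf x).carrier ⊆ x.carrier.image f :=
  Finsupp.mapDomain_support

open Classical in
theorem continuous_map (f : ι → κ) (hf : ∀ s ∈ K, s.image f ∈ L) : Continuous (map f hf) := by
  refine continuous_of_closedCell fun s hs => ?_
  let := cellTopology K s
  let := cellTopology L (s.image f)
  let φ : closedCell K s → closedCell L (s.image f) := fun x =>
    ⟨map f hf x.1, (map_carrier_subset f hf x.1).trans (Finset.image_subset_image x.2)⟩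
  refine (continuous_closedCell_val (hf s hs)).comp (f := φ) ?_
  refine continuous_induced_rng.2 (continuous_pi fun j => ?_)
  -- The sum defining `mapDomain` runs over the support, which varies with `x`; over the fixed set
  -- `s` it is visibly continuous.
  have key : ∀ x : closedCell K s,
      (φ x).1.coord j = ∑ i ∈ s, if f i = j then x.1.coord i else 0 := by
    intro x
    change Finsupp.mapDomain f x.1.coord j = _
    rw [Finsupp.mapDomain, Finsupp.sum_of_support_subset _ x.2 _ (by simp), Finsupp.finsetSum_apply]
    simp only [Finsupp.single_apply]
  change Continuous fun x => (φ x).1.coord j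
  simp only [key]
  refine continuous_finsetSum s fun i _ => ?_
  by_cases h : f i = j
  · simpa only [if_pos h] using continuous_closedCell_coord s i
  · simpa only [if_neg h] using continuous_const

/-- A full subcomplex is a subcomplex. -/
theorem isSubcomplex_setOf_carrier (T : Set ι) :
    IsSubcomplex {x : Realization K | ∀ p ∈ x.carrier, p ∈ T} := by
  refine ⟨{s | s ∈ K ∧ ∀ p ∈ s, p ∈ T}, fun s hs => hs.1, ?_⟩
  ext x
  simp only [Set.mem_ofPred_eq, Set.mem_iUnion, closedCell, exists_prop]
  exact ⟨fun h => ⟨x.carrier, ⟨x.support_mem, h⟩, subset_rfl⟩,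
    fun ⟨s, hs, hx⟩ p hp => hs.2 p (hx hp)⟩

end Realization

/-! ### Functoriality of the realization of posets -/

section Realize

variable {P Q R : Type*} [PartialOrder P] [PartialOrder Q] [PartialOrder R]

theorem continuous_realize (f : P →o Q) : Continuous (realize f) :=
  Realization.continuous_map _ _

theorem realize_coord (f : P →o Q) (x : Realization (orderComplex P)) :
    (realize f x).coord = x.coord.mapDomain f := rfl

theorem realize_realize (g : Q →o R) (f : P →o Q) (x : Realization (orderComplex P)) :
    realize g (realize f x) = realize (g.comp f) x :=
  Realization.ext (by simp only [realize_coord, ← Finsupp.mapDomain_comp]; rfl)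

theorem realize_eq_self {f : P →o P} {x : Realization (orderComplex P)}
    (h : ∀ p ∈ x.carrier, f p = p) : realize f x = x :=
  Realization.ext (by
    rw [realize_coord, Finsupp.mapDomain_congr (g := id) h, Finsupp.mapDomain_id])

theorem carrier_realize_subset {f : P →o Q} {x : Realization (orderComplex P)} :
    ∀ q ∈ (realize f x).carrier, ∃ p ∈ x.carrier, f p = q := by
  classical
  intro q hq
  simpa using Realization.map_carrier_subset _ (image_mem_orderComplex f) x hq

/-- A finite nonempty chain has a least element. -/
theorem exists_least {s : Finset P} (hs : s ∈ orderComplex P) : ∃ p ∈ s, ∀ q ∈ s, p ≤ q := by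
  obtain ⟨p, hp⟩ := s.exists_minimal hs.1
  refine ⟨p, hp.1, fun q hq => ?_⟩
  rcases hs.2.total hp.1 hq with h | h
  · exact h
  · exact hp.2 hq h

end Realize

/-! ### The type of a class -/

namespace MM

variable {V : Type*} {Γ : SimpleGraph V}

variable (Γ) in
/-- The poset map `[X, A] ↦ A`. -/
def typeHom : MM Γ →o VertexType Γ where
  toFun := Quotient.lift (fun m : MarkedVertexType Γ => m.type) fun _ _ h => h.1
  monotone' := by
    rintro _ _ ⟨m, n, hmn, rfl, rfl⟩
    exact hmn.2

@[simp]
theorem typeHom_smul (g : POut Γ) (x : MM Γ) : typeHom Γ (g • x) = typeHom Γ x := by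
  obtain ⟨α, rfl⟩ := QuotientGroup.mk_surjective g
  exact ind (p := fun x => typeHom Γ ((QuotientGroup.mk α : POut Γ) • x) = typeHom Γ x)
    (fun X A => rfl) x

theorem ofVertexType_le_iff (A B : VertexType Γ) :
    ofVertexType Γ A ≤ ofVertexType Γ B ↔ A ≤ B :=
  ⟨fun h => (typeHom Γ).monotone h, fun h => (ofVertexType Γ).monotone h⟩

theorem smul_le_smul_iff (g : POut Γ) (x y : MM Γ) : g • x ≤ g • y ↔ x ≤ y :=
  ⟨fun h => by simpa using smul_mono g⁻¹ h, smul_mono g⟩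

/-- A change of marking carried by `A` is carried by every larger type, so any marking of a vertex
also marks everything above it. -/
theorem exists_mk_eq_of_le {X : OrderedBasis Γ} {A : VertexType Γ} {y : MM Γ} (h : mk X A ≤ y) :
    ∃ B, A ≤ B ∧ y = mk X B := by
  obtain ⟨⟨Y, A'⟩, ⟨_, B⟩, ⟨rfl, hAB⟩, h, rfl⟩ := h
  obtain rfl : A = A' := mk_eq_type h
  exact ⟨B, hAB, (mk_eq_of_le hAB h).symm⟩

/-- Comparable classes have representatives with the same basis, so only their types can differ. -/
theorem eq_of_le_of_typeHom_eq {x y : MM Γ} (h : x ≤ y) (ht : typeHom Γ x = typeHom Γ y) :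
    x = y := by
  obtain ⟨⟨X, A⟩, ⟨_, B⟩, ⟨rfl, hAB⟩, rfl, rfl⟩ := h
  obtain rfl : A = B := ht
  rfl

theorem stabilizer_mono {x y : MM Γ} (h : x ≤ y) :
    MulAction.stabilizer (POut Γ) x ≤ MulAction.stabilizer (POut Γ) y := by
  intro g hg
  obtain ⟨α, rfl⟩ := QuotientGroup.mk_surjective g
  obtain ⟨⟨X, A⟩, ⟨_, B⟩, ⟨rfl, hAB⟩, rfl, rfl⟩ := h
  exact mk_eq_of_le hAB hg

-- Both `x` and `g • x` lie in the chain, hence are comparable, and the action preserves types.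
open scoped Pointwise in
theorem smul_eq_of_mem_cellStabilizer {σ : Finset (MM Γ)} (hσ : σ ∈ Complex Γ) {g : POut Γ}
    (hg : g ∈ cellStabilizer σ) {x : MM Γ} (hx : x ∈ σ) : g • x = x := by
  have hgx : g • x ∈ σ := by
    have h : g • x ∈ g • (σ : Set (MM Γ)) := Set.smul_mem_smul_set (Finset.mem_coe.2 hx)
    rw [MulAction.mem_stabilizer_iff.1 hg] at h
    exact h
  rcases hσ.2.total hgx hx with h | h
  · exact eq_of_le_of_typeHom_eq h (typeHom_smul g x)
  · exact (eq_of_le_of_typeHom_eq h (typeHom_smul g x).symm).symm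

-- By `stabilizer_mono`, fixing the least vertex already fixes every vertex above it.
open scoped Pointwise in
theorem cellStabilizer_eq_stabilizer {σ : Finset (MM Γ)} (hσ : σ ∈ Complex Γ) {x : MM Γ}
    (hx : x ∈ σ) (hmin : ∀ y ∈ σ, x ≤ y) :
    cellStabilizer σ = MulAction.stabilizer (POut Γ) x := by
  refine le_antisymm (fun g hg => smul_eq_of_mem_cellStabilizer hσ hg hx) fun g hg => ?_
  have hfix : ∀ y ∈ σ, g • y = y := fun y hy => stabilizer_mono (hmin y hy) hg
  refine MulAction.mem_stabilizer_iff.2 (Set.ext fun y => ⟨?_, fun hy => ?_⟩)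
  · rintro ⟨z, hz, rfl⟩
    change g • z ∈ _
    rwa [hfix z hz]
  · exact ⟨y, hy, hfix y hy⟩

/-! ### The action on the realization and its fundamental domain -/

theorem smul_realization_def (g : POut Γ) (x : Realization (Complex Γ)) :
    g • x = realize (smulHom g) x := rfl

instance : ContinuousConstSMul (POut Γ) (Realization (Complex Γ)) :=
  ⟨fun g => continuous_realize (smulHom g)⟩

theorem smul_eq_of_mem_closedCell {σ : Finset (MM Γ)} (hσ : σ ∈ Complex Γ) {g : POut Γ}
    (hg : g ∈ cellStabilizer σ) {x : Realization (Complex Γ)}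
    (hx : x ∈ Realization.closedCell (Complex Γ) σ) : g • x = x :=
  realize_eq_self fun _ hp => smul_eq_of_mem_cellStabilizer hσ hg (hx hp)

theorem leftInverse_realize_typeHom :
    Function.LeftInverse (realize (typeHom Γ)) (realize (ofVertexType Γ)) := fun x => by
  rw [realize_realize]
  exact realize_eq_self fun _ _ => rfl

theorem isClosedEmbedding_realize_ofVertexType :
    Topology.IsClosedEmbedding (realize (ofVertexType Γ)) :=
  leftInverse_realize_typeHom.isClosedEmbedding (continuous_realize _) (continuous_realize _)

theorem range_realize_ofVertexType :
    Set.range (realize (ofVertexType Γ)) =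
      {x | ∀ p ∈ x.carrier, p ∈ Set.range (ofVertexType Γ)} := by
  ext x
  constructor
  · rintro ⟨x, rfl⟩ p hp
    obtain ⟨A, -, rfl⟩ := carrier_realize_subset p hp
    exact ⟨A, rfl⟩
  · intro hx
    refine ⟨realize (typeHom Γ) x, ?_⟩
    rw [realize_realize]
    refine realize_eq_self fun p hp => ?_
    obtain ⟨A, rfl⟩ := hx p hp
    rfl

theorem realize_typeHom_smul (g : POut Γ) (x : Realization (Complex Γ)) :
    realize (typeHom Γ) (g • x) = realize (typeHom Γ) x := by
  rw [smul_realization_def, realize_realize]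
  congr 1
  exact OrderHom.ext _ _ (funext fun y => typeHom_smul g y)

theorem isStrongFundamentalDomain_range_realize :
    Realization.IsStrongFundamentalDomain (POut Γ) (Set.range (realize (ofVertexType Γ))) := by
  refine ⟨range_realize_ofVertexType ▸ Realization.isSubcomplex_setOf_carrier _, fun x => ?_⟩
  -- If `δ(V)` marks the least vertex of the carrier, it marks all of them, so `δ⁻¹` moves the whole
  -- carrier into the standard copy at once.
  obtain ⟨p, hp, hmin⟩ := exists_least x.support_mem
  obtain ⟨X, A, rfl⟩ : ∃ X A, p = mk X A :=
    ind (p := fun p => ∃ X A, p = mk X A) (fun X A => ⟨X, A, rfl⟩) p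
  obtain ⟨δ, rfl⟩ := exists_smul_stdBasis X
  have hz : (QuotientGroup.mk δ : POut Γ)⁻¹ • x ∈ Set.range (realize (ofVertexType Γ)) := by
    rw [range_realize_ofVertexType]
    intro r hr
    obtain ⟨q, hq, rfl⟩ := carrier_realize_subset r hr
    obtain ⟨B, -, rfl⟩ := exists_mk_eq_of_le (hmin q hq)
    exact ⟨B, eq_inv_smul_iff.2 (mk_smul_mk δ (stdBasis Γ) B)⟩
  refine ⟨_, ⟨hz, MulAction.mem_orbit _ _⟩, ?_⟩
  -- A point of the standard copy is recovered from its image under the type map, which is constant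
  -- on orbits.
  rintro _ ⟨⟨y, rfl⟩, ⟨g, hg⟩⟩
  obtain ⟨z, hz⟩ := hz
  rw [← hz, ← leftInverse_realize_typeHom y, ← leftInverse_realize_typeHom z, hz, ← hg]
  congr 1
  exact (realize_typeHom_smul g x).trans (realize_typeHom_smul _ x).symm

end MM

/-! ### Exponents of conjugators -/

/-- The integral Heisenberg group. -/
@[ext]
structure Heisenberg where
  x : ℤ
  y : ℤ
  z : ℤ

namespace Heisenberg

instance : One Heisenberg := ⟨⟨0, 0, 0⟩⟩
instance : Mul Heisenberg := ⟨fun p q => ⟨p.x + q.x, p.y + q.y, p.z + q.z + p.x * q.y⟩⟩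
instance : Inv Heisenberg := ⟨fun p => ⟨-p.x, -p.y, -p.z + p.x * p.y⟩⟩

@[simp] theorem one_x : (1 : Heisenberg).x = 0 := rfl
@[simp] theorem one_y : (1 : Heisenberg).y = 0 := rfl
@[simp] theorem one_z : (1 : Heisenberg).z = 0 := rfl
@[simp] theorem mul_x (p q : Heisenberg) : (p * q).x = p.x + q.x := rfl
@[simp] theorem mul_y (p q : Heisenberg) : (p * q).y = p.y + q.y := rfl
@[simp] theorem mul_z (p q : Heisenberg) : (p * q).z = p.z + q.z + p.x * q.y := rfl
@[simp] theorem inv_x (p : Heisenberg) : p⁻¹.x = -p.x := rfl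
@[simp] theorem inv_y (p : Heisenberg) : p⁻¹.y = -p.y := rfl
@[simp] theorem inv_z (p : Heisenberg) : p⁻¹.z = -p.z + p.x * p.y := rfl

instance : Group Heisenberg :=
  Group.ofLeftAxioms (fun p q r => by ext <;> simp <;> ring) (fun p => by ext <;> simp)
    (fun p => by ext <;> simp)

/-- The projection to the first coordinate. -/
def xHom : Heisenberg →* Multiplicative ℤ where
  toFun p := Multiplicative.ofAdd p.x
  map_one' := rfl
  map_mul' _ _ := rfl

end Heisenberg

variable {V : Type*} {Γ : SimpleGraph V}

theorem mem_vstar_self (a : V) : a ∈ vstar Γ a := Or.inl rfl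

theorem mem_vstar_comm {a b : V} : a ∈ vstar Γ b ↔ b ∈ vstar Γ a :=
  or_congr eq_comm (Γ.adj_comm b a)

/-- A map from the generators to a group that respects the commutation relations extends to
`A_Γ`. -/
def liftRAAG {G : Type*} [Group G] (f : V → G) (hf : ∀ v w, Γ.Adj v w → Commute (f v) (f w)) :
    RAAG Γ →* G :=
  PresentedGroup.toGroup (f := f) (by
    rintro _ ⟨v, w, h, rfl⟩
    simp [(hf v w h).eq])

@[simp]
theorem liftRAAG_gen {G : Type*} [Group G] (f : V → G)
    (hf : ∀ v w, Γ.Adj v w → Commute (f v) (f w)) (v : V) : liftRAAG f hf (gen Γ v) = f v :=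
  PresentedGroup.toGroup.of _

theorem hom_ext_gen {G : Type*} [Group G] {f g : RAAG Γ →* G}
    (h : ∀ v, f (gen Γ v) = g (gen Γ v)) : f = g :=
  PresentedGroup.ext h

theorem PAut.ext_gen {α β : PAut Γ}
    (h : ∀ v, (α : MulAut (RAAG Γ)) (gen Γ v) = (β : MulAut (RAAG Γ)) (gen Γ v)) : α = β :=
  Subtype.ext (MulEquiv.toMonoidHom_injective (hom_ext_gen h))

theorem PAut.exists_apply_gen (α : PAut Γ) (v : V) :
    ∃ g, (α : MulAut (RAAG Γ)) (gen Γ v) = g * gen Γ v * g⁻¹ := by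
  obtain ⟨g, hg⟩ := isConj_iff.1 (α.2 v)
  exact ⟨g, hg.symm⟩

open Classical in
/-- The exponent sum of `a` in an element of `A_Γ`. -/
noncomputable def expSum (a : V) : RAAG Γ →* Multiplicative ℤ :=
  liftRAAG (fun v => if v = a then Multiplicative.ofAdd 1 else 1) fun _ _ _ => Commute.all _ _

theorem expSum_gen_self (a : V) : expSum a (gen Γ a) = Multiplicative.ofAdd 1 := by
  simp [expSum]

theorem expSum_gen_of_ne {a b : V} (h : b ≠ a) : expSum a (gen Γ b) = 1 := by
  simp [expSum, h]

/-- Generators go to conjugates and the target of `expSum` is abelian. -/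
theorem expSum_apply (a : V) (α : PAut Γ) (g : RAAG Γ) :
    expSum a ((α : MulAut (RAAG Γ)) g) = expSum a g := by
  have : (expSum a).comp (α : MulAut (RAAG Γ)).toMonoidHom = expSum (Γ := Γ) a :=
    hom_ext_gen fun v => by
      obtain ⟨g, hg⟩ := PAut.exists_apply_gen α v
      change expSum a ((α : MulAut (RAAG Γ)) (gen Γ v)) = _
      rw [hg, map_mul, map_mul, map_inv, mul_inv_cancel_comm]
  exact DFunLike.congr_fun this g

open Classical in
/-- For `b ∉ st(a)`, the map to the Heisenberg group that kills all generators but `a` and `b`. -/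
noncomputable def toHeisenberg {a b : V} (h : b ∉ vstar Γ a) : RAAG Γ →* Heisenberg :=
  liftRAAG (fun v => if v = a then ⟨1, 0, 0⟩ else if v = b then ⟨0, 1, 0⟩ else 1) (by
    -- The images of `a` and `b` are the only ones that fail to commute, and `a`, `b` are not
    -- adjacent.
    intro v w hvw
    have hne := hvw.ne
    have hab : ¬ Γ.Adj a b := fun hab => h (Or.inr hab)
    have hba : ¬ Γ.Adj b a := fun hba => hab hba.symm
    split_ifs <;> subst_vars <;> simp_all)

theorem toHeisenberg_gen_right {a b : V} (h : b ∉ vstar Γ a) :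
    toHeisenberg h (gen Γ b) = ⟨0, 1, 0⟩ := by
  have : b ≠ a := fun hb => h (Or.inl hb)
  simp [toHeisenberg, this]

theorem toHeisenberg_x {a b : V} (h : b ∉ vstar Γ a) (g : RAAG Γ) :
    (toHeisenberg h g).x = (expSum a g).toAdd := by
  have : Heisenberg.xHom.comp (toHeisenberg h) = expSum a := hom_ext_gen fun v => by
    simp only [MonoidHom.comp_apply, toHeisenberg, expSum, liftRAAG_gen]
    split_ifs <;> rfl
  exact congrArg Multiplicative.toAdd (DFunLike.congr_fun this g)

/-- Conjugating `(0, 1, 0)` by `(x, y, z)` gives `(0, 1, x)`. So the exponent of `a` in a conjugator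
depends only on the conjugate of `b`, although the conjugator itself is not unique. -/
theorem toHeisenberg_conj_z {a b : V} (h : b ∉ vstar Γ a) (g : RAAG Γ) :
    (toHeisenberg h (g * gen Γ b * g⁻¹)).z = (expSum a g).toAdd := by
  rw [← toHeisenberg_x h]
  simp only [map_mul, map_inv, toHeisenberg_gen_right, Heisenberg.mul_z, Heisenberg.mul_x,
    Heisenberg.inv_z, Heisenberg.inv_y]
  ring

/-- For `b ∉ st(a)`, the exponent sum of `a` in `g`, where `α(b) = g b g⁻¹`. -/
noncomputable def twistExp {a b : V} (h : b ∉ vstar Γ a) : PAut Γ →* Multiplicative ℤ where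
  toFun α := Multiplicative.ofAdd (toHeisenberg h ((α : MulAut (RAAG Γ)) (gen Γ b))).z
  map_one' := by
    change Multiplicative.ofAdd (toHeisenberg h (gen Γ b)).z = 1
    rw [toHeisenberg_gen_right, ofAdd_zero]
  map_mul' α β := by
    obtain ⟨g, hg⟩ := PAut.exists_apply_gen α b
    obtain ⟨k, hk⟩ := PAut.exists_apply_gen β b
    -- A conjugator for the composite is `α(k) g`. Since `α` preserves exponent sums, the exponents
    -- add.
    have : ((α * β : PAut Γ) : MulAut (RAAG Γ)) (gen Γ b) =
        ((α : MulAut (RAAG Γ)) k * g) * gen Γ b * ((α : MulAut (RAAG Γ)) k * g)⁻¹ := by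
      rw [Subgroup.coe_mul, MulAut.mul_apply, hk, map_mul, map_mul, hg, map_inv]
      group
    rw [this, hg, hk, toHeisenberg_conj_z, toHeisenberg_conj_z, toHeisenberg_conj_z, map_mul,
      expSum_apply, toAdd_mul, add_comm, ofAdd_add]

theorem twistExp_eq {a b : V} (h : b ∉ vstar Γ a) {α : PAut Γ} {g : RAAG Γ}
    (hg : (α : MulAut (RAAG Γ)) (gen Γ b) = g * gen Γ b * g⁻¹) : twistExp h α = expSum a g := by
  change Multiplicative.ofAdd (toHeisenberg h ((α : MulAut (RAAG Γ)) (gen Γ b))).z = _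
  rw [hg, toHeisenberg_conj_z, ofAdd_toAdd]

/-- For `b, c ∉ st(a)`, the difference of the exponents of `a` in the conjugators of `b` and `c`. -/
noncomputable def relExp {a b c : V} (hb : b ∉ vstar Γ a) (hc : c ∉ vstar Γ a) :
    POut Γ →* Multiplicative ℤ :=
  QuotientGroup.lift (Inn Γ) (twistExp hb / twistExp hc) (by
    -- An inner automorphism conjugates `b` and `c` by the same element, so the two exponents
    -- cancel.
    rintro α ⟨g, hg⟩
    have h : ∀ v, (α : MulAut (RAAG Γ)) (gen Γ v) = g * gen Γ v * g⁻¹ := fun v => by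
      rw [← MulAut.conj_apply, hg]; rfl
    rw [MonoidHom.mem_ker, MonoidHom.div_apply, twistExp_eq hb (h b), twistExp_eq hc (h c),
      div_self'])

/-! ### Twists by powers of one generator -/

/-- `α` conjugates every generator `b` by `a ^ k b`. -/
def IsTwist (a : V) (k : V → ℤ) (α : PAut Γ) : Prop :=
  ∀ b, (α : MulAut (RAAG Γ)) (gen Γ b) = gen Γ a ^ k b * gen Γ b * (gen Γ a ^ k b)⁻¹

theorem conj_zpow_gen_of_mem {a b : V} (h : b ∈ vstar Γ a) (n : ℤ) :
    gen Γ a ^ n * gen Γ b * (gen Γ a ^ n)⁻¹ = gen Γ b := by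
  rw [((commute_gen h).zpow_left n).eq, mul_inv_cancel_right]

namespace IsTwist

variable {a : V} {k l : V → ℤ} {α β : PAut Γ}

theorem apply_of_mem (h : IsTwist a k α) {b : V} (hb : b ∈ vstar Γ a) :
    (α : MulAut (RAAG Γ)) (gen Γ b) = gen Γ b := by
  rw [h b, conj_zpow_gen_of_mem hb]

theorem apply_of_eq_zero (h : IsTwist a k α) {b : V} (hb : k b = 0) :
    (α : MulAut (RAAG Γ)) (gen Γ b) = gen Γ b := by
  simp [h b, hb]

theorem mul (hα : IsTwist a k α) (hβ : IsTwist a l β) : IsTwist a (k + l) (α * β) := by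
  intro b
  rw [Subgroup.coe_mul, MulAut.mul_apply, hβ b]
  simp only [map_mul, map_zpow, map_inv, hα b, hα.apply_of_mem (mem_vstar_self a), Pi.add_apply]
  rw [add_comm, zpow_add]
  group

theorem one (a : V) : IsTwist (Γ := Γ) a 0 1 := fun b => by simp

/-- Powers of `a` centralize `st(a)`, so the values of `k` there are irrelevant and `α` is
conjugation by `a ^ n`. -/
theorem mk_eq_one (h : IsTwist a k α) (n : ℤ) (hn : ∀ b ∉ vstar Γ a, k b = n) :
    (QuotientGroup.mk α : POut Γ) = 1 := by
  rw [QuotientGroup.eq_one_iff]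
  refine ⟨gen Γ a ^ n, MulEquiv.toMonoidHom_injective (hom_ext_gen fun b => ?_)⟩
  change gen Γ a ^ n * gen Γ b * (gen Γ a ^ n)⁻¹ = (α : MulAut (RAAG Γ)) (gen Γ b)
  by_cases hb : b ∈ vstar Γ a
  · rw [conj_zpow_gen_of_mem hb, h.apply_of_mem hb]
  · rw [h b, hn b hb]

theorem relExp_mk {b c : V} (hb : b ∉ vstar Γ a) (hc : c ∉ vstar Γ a) (h : IsTwist a k α) :
    relExp hb hc (QuotientGroup.mk α) = Multiplicative.ofAdd (k b - k c) := by
  change twistExp hb α / twistExp hc α = _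
  rw [twistExp_eq hb (h b), twistExp_eq hc (h c), map_zpow, map_zpow, expSum_gen_self,
    ← ofAdd_zsmul, ← ofAdd_zsmul, ← ofAdd_sub]
  simp

theorem relExp_mk_of_ne {d b c : V} (hb : b ∉ vstar Γ d) (hc : c ∉ vstar Γ d) (hd : a ≠ d)
    (h : IsTwist a k α) : relExp hb hc (QuotientGroup.mk α) = 1 := by
  change twistExp hb α / twistExp hc α = _
  rw [twistExp_eq hb (h b), twistExp_eq hc (h c), map_zpow, map_zpow, expSum_gen_of_ne hd]
  simp

/-- Each twist fixes both `a` and `b`, so conjugators multiply, and powers of `a` and `b` commute.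
-/
theorem commute_of_mem {b : V} (hα : IsTwist a k α) (hβ : IsTwist b l β) (hb : b ∈ vstar Γ a) :
    Commute α β := by
  refine PAut.ext_gen fun c => ?_
  have hαb := hα.apply_of_mem hb
  have hβa := hβ.apply_of_mem (mem_vstar_comm.2 hb)
  have hab : gen Γ a ^ k c * gen Γ b ^ l c = gen Γ b ^ l c * gen Γ a ^ k c :=
    ((commute_gen hb).zpow_zpow _ _).eq
  simp only [Subgroup.coe_mul, MulAut.mul_apply]
  rw [hβ c, hα c]
  simp only [map_mul, map_zpow, map_inv, hα c, hβ c, hαb, hβa]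
  calc gen Γ b ^ l c * (gen Γ a ^ k c * gen Γ c * (gen Γ a ^ k c)⁻¹) * (gen Γ b ^ l c)⁻¹
      = (gen Γ b ^ l c * gen Γ a ^ k c) * gen Γ c * (gen Γ b ^ l c * gen Γ a ^ k c)⁻¹ := by group
    _ = (gen Γ a ^ k c * gen Γ b ^ l c) * gen Γ c * (gen Γ a ^ k c * gen Γ b ^ l c)⁻¹ := by
      rw [hab]
    _ = _ := by group

/-- No generator is moved by both twists, and each twist fixes the conjugators used by the other. -/
theorem commute_of_fix {b : V} (hα : IsTwist a k α) (hβ : IsTwist b l β)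
    (hαb : (α : MulAut (RAAG Γ)) (gen Γ b) = gen Γ b)
    (hβa : (β : MulAut (RAAG Γ)) (gen Γ a) = gen Γ a)
    (h : ∀ c, (α : MulAut (RAAG Γ)) (gen Γ c) = gen Γ c ∨
      (β : MulAut (RAAG Γ)) (gen Γ c) = gen Γ c) : Commute α β := by
  refine PAut.ext_gen fun c => ?_
  simp only [Subgroup.coe_mul, MulAut.mul_apply]
  rcases h c with hc | hc
  · rw [hc, hβ c]
    simp only [map_mul, map_zpow, map_inv, hc, hαb]
  · rw [hc, hα c]
    simp only [map_mul, map_zpow, map_inv, hc, hβa]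

/-- A twist can be normalized by an inner automorphism to fix a given generator. -/
theorem exists_mk_eq (h : IsTwist a k α) (n : ℤ) :
    ∃ β : PAut Γ, IsTwist a (fun b => k b - n) β ∧
      (QuotientGroup.mk β : POut Γ) = QuotientGroup.mk α := by
  have hmem : MulAut.conj (gen Γ a ^ (-n)) ∈ PAut Γ := fun v =>
    isConj_iff.2 ⟨gen Γ a ^ (-n), rfl⟩
  have hconj : IsTwist a (fun _ => -n) ⟨MulAut.conj (gen Γ a ^ (-n)), hmem⟩ := fun b => rfl
  refine ⟨α * ⟨MulAut.conj (gen Γ a ^ (-n)), hmem⟩, h.mul hconj, ?_⟩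
  rw [QuotientGroup.mk_mul, hconj.mk_eq_one (-n) fun _ _ => rfl, mul_one]

/-- The prescribed images satisfy the commutation relations, and the twist with exponents `-k` is
the inverse. -/
theorem exists_of_adj (a : V) (k : V → ℤ)
    (hk : ∀ b ∉ vstar Γ a, ∀ c ∉ vstar Γ a, Γ.Adj b c → k b = k c) :
    ∃ α : PAut Γ, IsTwist a k α := by
  have hc : ∀ k : V → ℤ, (∀ b ∉ vstar Γ a, ∀ c ∉ vstar Γ a, Γ.Adj b c → k b = k c) →
      ∀ b c, Γ.Adj b c → Commute (gen Γ a ^ k b * gen Γ b * (gen Γ a ^ k b)⁻¹)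
        (gen Γ a ^ k c * gen Γ c * (gen Γ a ^ k c)⁻¹) := by
    intro k hk b c hbc
    have hcomm : Commute (gen Γ b) (gen Γ c) := commute_gen (Or.inr hbc)
    have key : ∀ n : ℤ, Commute (gen Γ a ^ n * gen Γ b * (gen Γ a ^ n)⁻¹)
        (gen Γ a ^ n * gen Γ c * (gen Γ a ^ n)⁻¹) := fun n => by
      simpa only [MulAut.conj_apply, MulEquiv.coe_toMonoidHom] using
        hcomm.map (MulAut.conj (gen Γ a ^ n)).toMonoidHom
    -- A vertex of `st(a)` is unaffected by its exponent, which can be replaced by its neighbour's;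
    -- two commuting elements conjugated by the same power still commute.
    by_cases hb : b ∈ vstar Γ a
    · rw [conj_zpow_gen_of_mem hb, ← conj_zpow_gen_of_mem hb (k c)]
      exact key _
    · by_cases hc : c ∈ vstar Γ a
      · rw [conj_zpow_gen_of_mem hc, ← conj_zpow_gen_of_mem hc (k b)]
        exact key _
      · rw [hk b hb c hc hbc]
        exact key _
  have hk' : ∀ b ∉ vstar Γ a, ∀ c ∉ vstar Γ a, Γ.Adj b c → (-k) b = (-k) c :=
    fun b hb c hc h => congrArg Neg.neg (hk b hb c hc h)
  have hinv : ∀ k l : V → ℤ, k + l = 0 → ∀ hk hl,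
      (liftRAAG (fun b => gen Γ a ^ k b * gen Γ b * (gen Γ a ^ k b)⁻¹) hk).comp
        (liftRAAG (fun b => gen Γ a ^ l b * gen Γ b * (gen Γ a ^ l b)⁻¹) hl) =
        MonoidHom.id (RAAG Γ) := by
    intro k l hkl hk hl
    refine hom_ext_gen fun b => ?_
    have hb : k b = -l b := eq_neg_of_add_eq_zero_left (congrFun hkl b)
    simp only [MonoidHom.comp_apply, liftRAAG_gen, map_mul, map_zpow, map_inv, MonoidHom.id_apply,
      conj_zpow_gen_of_mem (mem_vstar_self a), hb]
    group
  let e : MulAut (RAAG Γ) := MonoidHom.toMulEquiv (liftRAAG _ (hc k hk)) (liftRAAG _ (hc (-k) hk'))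
    (hinv (-k) k (neg_add_cancel k) _ _) (hinv k (-k) (add_neg_cancel k) _ _)
  have he : ∀ b, e (gen Γ b) = gen Γ a ^ k b * gen Γ b * (gen Γ a ^ k b)⁻¹ := fun b =>
    liftRAAG_gen (fun b => gen Γ a ^ k b * gen Γ b * (gen Γ a ^ k b)⁻¹) (hc k hk) b
  exact ⟨⟨e, fun b => isConj_iff.2 ⟨_, (he b).symm⟩⟩, he⟩

end IsTwist

/-! ### The carried subgroups -/

theorem IsUnionOfComponents.mem_of_adj {a b c : V} {P : Set V} (hP : IsUnionOfComponents Γ a P)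
    (hb : b ∈ P) (hc : c ∉ vstar Γ a) (hbc : Γ.Adj b c) : c ∈ P := by
  obtain ⟨S, rfl⟩ := hP
  simp only [Set.mem_iUnion, Set.mem_image] at hb ⊢
  obtain ⟨C, hC, b, hbC, rfl⟩ := hb
  refine ⟨C, hC, ⟨c, hc⟩, ?_, rfl⟩
  rw [SimpleGraph.ConnectedComponent.mem_supp_iff] at hbC ⊢
  rw [← hbC]
  exact (SimpleGraph.ConnectedComponent.connectedComponentMk_eq_of_adj
    (G := Γ.induce (vstar Γ a)ᶜ) (v := b) (w := ⟨c, hc⟩) hbc).symm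

namespace BasedPartition

variable {a : V} (A : BasedPartition Γ a)

theorem notMem_vstar {P : Set V} (hP : P ∈ A.petals) {b : V} (hb : b ∈ P) : b ∉ vstar Γ a := by
  have h : b ∈ ⋃₀ A.petals := ⟨P, hP, hb⟩
  rwa [A.sUnion_eq] at h

theorem exists_petal {b : V} (hb : b ∉ vstar Γ a) : ∃ P ∈ A.petals, b ∈ P := by
  have h : b ∈ ⋃₀ A.petals := by rwa [A.sUnion_eq]
  exact h

/-- The petal that contains `b`. -/
def petal (b : V) : Set V := ⋃₀ {P ∈ A.petals | b ∈ P}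

theorem petal_eq {P : Set V} (hP : P ∈ A.petals) {b : V} (hb : b ∈ P) : A.petal b = P := by
  have : {P ∈ A.petals | b ∈ P} = {P} := by
    ext Q
    exact ⟨fun hQ => A.disjoint.elim_set hQ.1 hP b hQ.2 hb, fun hQ => hQ ▸ ⟨hP, hb⟩⟩
  rw [petal, this, Set.sUnion_singleton]

/-- Petals are unions of components of `Γ - st(a)`, so adjacent vertices outside the star receive
equal exponents. -/
theorem exists_carries (n : Set V → ℤ) : ∃ α : PAut Γ, IsTwist a (fun b => n (A.petal b)) α ∧
    A.Carries α := by
  obtain ⟨α, hα⟩ := IsTwist.exists_of_adj (Γ := Γ) a (fun b => n (A.petal b)) (by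
    intro b hb c hc hbc
    obtain ⟨P, hP, hbP⟩ := A.exists_petal hb
    have hcP := (A.valid P hP).mem_of_adj hbP hc hbc
    simp only [A.petal_eq hP hbP, A.petal_eq hP hcP])
  refine ⟨α, hα, _, hα, fun P hP b hb c hc => ?_⟩
  simp only [A.petal_eq hP hb, A.petal_eq hP hc]

/-- The outer automorphisms carried by a based partition. -/
def carried : Subgroup (POut Γ) :=
  Subgroup.map (QuotientGroup.mk' (Inn Γ))
    { carrier := {α | A.Carries α}
      one_mem' := ⟨0, IsTwist.one a, fun _ _ _ _ _ _ => rfl⟩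
      mul_mem' := by
        rintro α β ⟨k, hk, hk'⟩ ⟨l, hl, hl'⟩
        exact ⟨k + l, IsTwist.mul hk hl, fun P hP b hb c hc =>
          congrArg₂ (· + ·) (hk' P hP b hb c hc) (hl' P hP b hb c hc)⟩
      inv_mem' := fun h => h.inv }

theorem mem_carried {x : POut Γ} :
    x ∈ A.carried ↔ ∃ α : PAut Γ, A.Carries α ∧ QuotientGroup.mk α = x := Iff.rfl

/-! ### Exponent coordinates on the subgroup carried by a based partition -/

/-- A chosen petal. -/
noncomputable def basePetal : Set V :=
  open Classical in if h : A.petals.Nonempty then h.some else ∅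

theorem basePetal_mem {P : Set V} (hP : P ∈ A.petals) : A.basePetal ∈ A.petals := by
  have h : A.petals.Nonempty := ⟨P, hP⟩
  rw [basePetal, dif_pos h]
  exact h.some_mem

/-- The petals other than the chosen one. -/
abbrev OtherPetal : Type _ := ↥(A.petals \ {A.basePetal})

/-- Conjugation by `a` shifts all exponents together, so one petal serves as reference and the
others give coordinates. Without petals both sides are `0`, by truncated subtraction. -/
theorem natCard_otherPetal [Finite V] : Nat.card A.OtherPetal = A.length - 1 := by
  change (A.petals \ {A.basePetal}).ncard = A.petals.ncard - 1
  rcases A.petals.eq_empty_or_nonempty with h | ⟨P, hP⟩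
  · simp [h]
  · exact Set.ncard_sdiff_singleton_of_mem (A.basePetal_mem hP)

/-- The coordinates on the carried subgroup: relative exponents of `a`. -/
noncomputable def exponents : POut Γ →* (A.OtherPetal → Multiplicative ℤ) :=
  MonoidHom.pi fun i => relExp
    (A.notMem_vstar i.2.1 (A.nonempty _ i.2.1).some_mem)
    (A.notMem_vstar (A.basePetal_mem i.2.1) (A.nonempty _ (A.basePetal_mem i.2.1)).some_mem)

theorem exponents_mk {k : V → ℤ} {α : PAut Γ} (h : IsTwist a k α)
    (hk : ∀ P ∈ A.petals, ∀ b ∈ P, ∀ c ∈ P, k b = k c) (i : A.OtherPetal) {b c : V} (hb : b ∈ i.1)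
    (hc : c ∈ A.basePetal) :
    A.exponents (QuotientGroup.mk α) i = Multiplicative.ofAdd (k b - k c) := by
  rw [hk _ i.2.1 b hb _ (A.nonempty _ i.2.1).some_mem,
    hk _ (A.basePetal_mem i.2.1) c hc _ (A.nonempty _ (A.basePetal_mem i.2.1)).some_mem]
  exact h.relExp_mk _ _

/-- The conjugators are powers of `b`, in which `a` has exponent sum zero. -/
theorem exponents_eq_one_of_ne {b : V} (B : BasedPartition Γ b) (hab : a ≠ b) {x : POut Γ}
    (hx : x ∈ B.carried) : A.exponents x = 1 := by
  obtain ⟨α, ⟨k, hk, -⟩, rfl⟩ := B.mem_carried.1 hx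
  exact funext fun i => IsTwist.relExp_mk_of_ne _ _ hab.symm hk

/-- If all relative exponents vanish, `k` is constant outside `st(a)` and the twist is inner. -/
theorem eq_one_of_exponents_eq_one {x : POut Γ} (hx : x ∈ A.carried) (h : A.exponents x = 1) :
    x = 1 := by
  obtain ⟨α, ⟨k, hk, hk'⟩, rfl⟩ := A.mem_carried.1 hx
  by_cases hP : A.petals.Nonempty
  · obtain ⟨c, hc⟩ := A.nonempty _ (A.basePetal_mem hP.some_mem)
    refine IsTwist.mk_eq_one hk (k c) fun b hb => ?_
    obtain ⟨P, hP, hbP⟩ := A.exists_petal hb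
    by_cases hP0 : P = A.basePetal
    · exact hk' P hP b hbP c (hP0 ▸ hc)
    · have hi := congrFun h ⟨P, hP, hP0⟩
      rw [A.exponents_mk hk hk' ⟨P, hP, hP0⟩ hbP hc] at hi
      exact sub_eq_zero.1 (Multiplicative.ofAdd.injective hi)
  -- Without petals `st(a)` is everything, so the condition on `k` is vacuous and any constant
  -- works.
  · refine IsTwist.mk_eq_one hk 0 fun b hb => ?_
    obtain ⟨P, hP', -⟩ := A.exists_petal hb
    exact (hP ⟨P, hP'⟩).elim

theorem exists_exponents_eq (n : A.OtherPetal → Multiplicative ℤ) :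
    ∃ x ∈ A.carried, A.exponents x = n := by
  classical
  -- The reference petal falls under the default value, so relative exponents equal the prescribed
  -- ones.
  let m : Set V → ℤ := fun P => if h : P ∈ A.petals \ {A.basePetal} then (n ⟨P, h⟩).toAdd else 0
  obtain ⟨α, hα, hA⟩ := A.exists_carries m
  refine ⟨_, A.mem_carried.2 ⟨α, hA, rfl⟩, funext fun i => ?_⟩
  obtain ⟨b, hb⟩ := A.nonempty _ i.2.1
  have hP0 := A.basePetal_mem i.2.1
  obtain ⟨c, hc⟩ := A.nonempty _ hP0
  rw [A.exponents_mk hα (fun P hP b hb c hc => by simp only [A.petal_eq hP hb, A.petal_eq hP hc])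
    i hb hc, A.petal_eq i.2.1 hb, A.petal_eq hP0 hc]
  have h1 : m i.1 = (n i).toAdd := dif_pos i.2
  have h2 : m A.basePetal = 0 := dif_neg fun h => h.2 rfl
  rw [h1, h2, sub_zero, ofAdd_toAdd]

/-! ### Compatible partitions carry commuting subgroups -/

variable {A}

/-- For non-adjacent `a ≠ b`, inner automorphisms normalize the twists so that the first is trivial
on the petal of `b` and the second on the petal of `a`. A generator moved by both would witness a
crossing. -/
theorem Compatible.commute {b : V} {B : BasedPartition Γ b} (h : A.Compatible B) {x y : POut Γ}
    (hx : x ∈ A.carried) (hy : y ∈ B.carried) : Commute x y := by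
  obtain ⟨α, ⟨k, hk, hk'⟩, rfl⟩ := A.mem_carried.1 hx
  obtain ⟨β, ⟨l, hl, hl'⟩, rfl⟩ := B.mem_carried.1 hy
  by_cases hab : a ∈ vstar Γ b
  · exact (IsTwist.commute_of_mem hk hl (mem_vstar_comm.1 hab)).map (QuotientGroup.mk' (Inn Γ))
  obtain ⟨α', hα', hα⟩ := IsTwist.exists_mk_eq hk (k b)
  obtain ⟨β', hβ', hβ⟩ := IsTwist.exists_mk_eq hl (l a)
  rw [← hα, ← hβ]
  refine Commute.map (f := QuotientGroup.mk' (Inn Γ)) ?_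
  refine hα'.commute_of_fix hβ' (hα'.apply_of_eq_zero (sub_self _))
    (hβ'.apply_of_eq_zero (sub_self _)) fun c => ?_
  by_cases hca : c ∈ vstar Γ a
  · exact Or.inl (hα'.apply_of_mem hca)
  by_cases hcb : c ∈ vstar Γ b
  · exact Or.inr (hβ'.apply_of_mem hcb)
  obtain ⟨P, hP, hcP⟩ := A.exists_petal hca
  obtain ⟨Q, hQ, hcQ⟩ := B.exists_petal hcb
  by_cases hbP : b ∈ P
  · exact Or.inl (hα'.apply_of_eq_zero (sub_eq_zero.2 (hk' P hP c hcP b hbP)))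
  by_cases haQ : a ∈ Q
  · exact Or.inr (hβ'.apply_of_eq_zero (sub_eq_zero.2 (hl' Q hQ c hcQ a haQ)))
  exact ((h.resolve_left hab) ⟨hab, P, hP, Q, hQ, haQ, hbP, c, hcP, hcQ⟩).elim

end BasedPartition

/-! ### Vertex stabilizers -/

theorem IsFreeAbelianOfRank.of_mulEquiv {G H : Type*} [Group G] [Group H] {n : ℕ} (e : G ≃* H)
    (h : IsFreeAbelianOfRank H n) : IsFreeAbelianOfRank G n :=
  h.map e.trans

theorem isFreeAbelianOfRank_pi (ι : Type*) [Finite ι] :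
    IsFreeAbelianOfRank (ι → Multiplicative ℤ) (Nat.card ι) :=
  ⟨(MulEquiv.arrowCongr (Finite.equivFin ι) (MulEquiv.refl (Multiplicative ℤ))).trans
    (MulEquiv.piMultiplicative fun _ : Fin (Nat.card ι) => ℤ).symm⟩

namespace MM

theorem mk_mem_stabilizer_iff (A : VertexType Γ) (α : PAut Γ) :
    (QuotientGroup.mk α : POut Γ) ∈ MulAction.stabilizer (POut Γ) (ofVertexType Γ A) ↔
      A.Carries α := by
  rw [MulAction.mem_stabilizer_iff, eq_comm]
  change mk (stdBasis Γ) A = mk (α • stdBasis Γ) A ↔ _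
  have := mk_eq_iff 1 α A A
  simpa using this

theorem stabilizer_eq_iSup (A : VertexType Γ) :
    MulAction.stabilizer (POut Γ) (ofVertexType Γ A) = ⨆ a, (A.part a).carried := by
  apply le_antisymm
  · intro x hx
    obtain ⟨α, rfl⟩ := QuotientGroup.mk_surjective x
    rw [mk_mem_stabilizer_iff] at hx
    induction hx using Submonoid.closure_induction with
    | mem α hα =>
      obtain ⟨a, ha⟩ := hα
      exact Subgroup.mem_iSup_of_mem a ⟨α, ha, rfl⟩
    | one => exact one_mem _
    | mul α β _ _ hα hβ => exact mul_mem hα hβ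
  · refine iSup_le fun a => ?_
    rintro _ ⟨α, hα, rfl⟩
    exact (mk_mem_stabilizer_iff A α).2 (Submonoid.subset_closure ⟨a, hα⟩)

/-- The carried subgroups commute pairwise and generate the stabilizer, and the exponents for `a`
see only the factor of `a`. So all exponents together form an isomorphism onto a power of `ℤ`. -/
theorem isFreeAbelianOfRank_stabilizer_ofVertexType [Fintype V] (A : VertexType Γ) :
    IsFreeAbelianOfRank (MulAction.stabilizer (POut Γ) (ofVertexType Γ A)) A.rank := by
  classical
  have hcomm : Pairwise fun a b : V => ∀ x y : POut Γ,
      x ∈ (A.part a).carried → y ∈ (A.part b).carried → Commute x y :=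
    fun a b _ x y hx hy => (A.compatible a b).commute hx hy
  let Θ := Subgroup.noncommPiCoprod hcomm
  have hΘ : Θ.range = MulAction.stabilizer (POut Γ) (ofVertexType Γ A) := by
    rw [stabilizer_eq_iSup, Subgroup.noncommPiCoprod_range]
  -- It suffices to compare the two homomorphisms on each single factor of the product.
  have hexp : ∀ a u, (A.part a).exponents (Θ u) = (A.part a).exponents (u a) := by
    intro a u
    have : (A.part a).exponents.comp Θ =
        ((A.part a).exponents.comp (A.part a).carried.subtype).comp
          (Pi.evalMonoidHom (fun a => (A.part a).carried) a) := by
      refine MonoidHom.pi_ext fun b y => ?_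
      simp only [MonoidHom.comp_apply, Θ, Subgroup.noncommPiCoprod_mulSingle,
        Pi.evalMonoidHom_apply]
      by_cases hab : a = b
      · subst hab
        rw [Pi.mulSingle_eq_same]
        rfl
      · rw [Pi.mulSingle_eq_of_ne hab, map_one, map_one]
        exact (A.part a).exponents_eq_one_of_ne (A.part b) hab y.2
    exact DFunLike.congr_fun this u
  let F : MulAction.stabilizer (POut Γ) (ofVertexType Γ A) →*
      ((p : Σ a, (A.part a).OtherPetal) → Multiplicative ℤ) :=
    MonoidHom.pi fun p => ((Pi.evalMonoidHom _ p.2).comp (A.part p.1).exponents).comp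
      (Subgroup.subtype _)
  have hinj : Function.Injective F := by
    rw [injective_iff_map_eq_one]
    rintro ⟨x, hx⟩ hF
    rw [← hΘ] at hx
    obtain ⟨u, rfl⟩ := hx
    -- By `hexp`, the vanishing of all exponents of the product forces each factor to be trivial.
    have hu : u = 1 := by
      refine funext fun a => Subtype.ext ((A.part a).eq_one_of_exponents_eq_one (u a).2 ?_)
      rw [← hexp]
      exact funext fun i => congrFun hF ⟨a, i⟩
    exact Subtype.ext ((congrArg Θ hu).trans (map_one Θ))
  have hsurj : Function.Surjective F := by
    intro n
    choose u hu hun using fun a => (A.part a).exists_exponents_eq fun i => n ⟨a, i⟩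
    refine ⟨⟨Θ fun a => ⟨u a, hu a⟩, hΘ ▸ ⟨_, rfl⟩⟩, funext fun p => ?_⟩
    change (A.part p.1).exponents (Θ fun a => ⟨u a, hu a⟩) p.2 = n p
    rw [hexp, hun]
  have hcard : Nat.card (Σ a, (A.part a).OtherPetal) = A.rank := by
    rw [Nat.card_sigma]
    exact Finset.sum_congr rfl fun a _ => (A.part a).natCard_otherPetal
  rw [← hcard]
  exact (isFreeAbelianOfRank_pi _).of_mulEquiv (MulEquiv.ofBijective F ⟨hinj, hsurj⟩)

theorem isFreeAbelianOfRank_stabilizer [Fintype V] (X : OrderedBasis Γ) (A : VertexType Γ) :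
    IsFreeAbelianOfRank (MulAction.stabilizer (POut Γ) (mk X A)) A.rank := by
  obtain ⟨δ, rfl⟩ := exists_smul_stdBasis X
  have h : ofVertexType Γ A = (QuotientGroup.mk δ : POut Γ)⁻¹ • mk (δ • stdBasis Γ) A :=
    eq_inv_smul_iff.2 (mk_smul_mk δ (stdBasis Γ) A)
  exact (isFreeAbelianOfRank_stabilizer_ofVertexType A).of_mulEquiv
    (MulAction.stabilizerEquivStabilizer h)

theorem exists_isFreeAbelianOfRank_cellStabilizer [Fintype V] {σ : Finset (MM Γ)}
    (hσ : σ ∈ Complex Γ) : ∃ n, IsFreeAbelianOfRank (cellStabilizer σ) n := by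
  obtain ⟨x, hx, hmin⟩ := exists_least hσ
  rw [cellStabilizer_eq_stabilizer hσ hx hmin]
  exact ind (p := fun x => ∃ n, IsFreeAbelianOfRank (MulAction.stabilizer (POut Γ) x) n)
    (fun X A => ⟨_, isFreeAbelianOfRank_stabilizer X A⟩) x

end MM

end GammaMM

/-! ### The theorem -/

open GammaMM in
theorem theoremA {V : Type*} [Fintype V] (Γ : SimpleGraph V) :
    -- the action of `ΣPOut(A_Γ)` on the complex `MM_Γ`
    (∀ (α : PAut Γ) (X : OrderedBasis Γ) (A : VertexType Γ),
      (QuotientGroup.mk α : POut Γ) • MM.mk X A = MM.mk (α • X) A) ∧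
    (∀ (g : POut Γ) (x y : MM Γ), g • x ≤ g • y ↔ x ≤ y) ∧
    ContinuousConstSMul (POut Γ) (Realization (MM.Complex Γ)) ∧
    -- every cell stabilizer is free abelian, and it fixes the cell pointwise
    (∀ σ ∈ MM.Complex Γ, (∃ n : ℕ, IsFreeAbelianOfRank (MM.cellStabilizer σ) n) ∧
      ∀ g ∈ MM.cellStabilizer σ, ∀ x ∈ Realization.closedCell (MM.Complex Γ) σ, g • x = x) ∧
    -- the stabilizer of the vertex `[X, A]` is free abelian of rank `r(A)`
    (∀ (X : OrderedBasis Γ) (A : VertexType Γ),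
      IsFreeAbelianOfRank (MulAction.stabilizer (POut Γ) (MM.mk X A)) A.rank) ∧
    -- `|Wh_Γ|` embeds as the full subcomplex on the vertices `[V_Γ, A]`, which is a strong
    -- fundamental domain
    (∀ A B : VertexType Γ, MM.ofVertexType Γ A ≤ MM.ofVertexType Γ B ↔ A ≤ B) ∧
    Topology.IsClosedEmbedding (realize (MM.ofVertexType Γ)) ∧
    Set.range (realize (MM.ofVertexType Γ)) =
      {x | ∀ p ∈ x.carrier, p ∈ Set.range (MM.ofVertexType Γ)} ∧
    Realization.IsStrongFundamentalDomain (POut Γ) (Set.range (realize (MM.ofVertexType Γ))) := by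
  exact ⟨MM.mk_smul_mk, MM.smul_le_smul_iff, inferInstance,
    fun σ hσ => ⟨MM.exists_isFreeAbelianOfRank_cellStabilizer hσ,
      fun g hg x hx => MM.smul_eq_of_mem_closedCell hσ hg hx⟩,
    MM.isFreeAbelianOfRank_stabilizer, MM.ofVertexType_le_iff,
    MM.isClosedEmbedding_realize_ofVertexType, MM.range_realize_ofVertexType,
    MM.isStrongFundamentalDomain_range_realize⟩
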